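/- Let $B=(B_t)_{t\ge 0}$ be a standard real Brownian motion on a probability space and let $c>0$. Define random times $0\le T_0\le T_1\le\cdots\le\infty$ and a process $U=(U_t)_{t\ge 0}$ path by path as follows (with $\inf\emptyset=\infty$). If $B$ reaches $c$ before $-c$, let $T_0=\inf\{t\ge 0: B_t=c\}$ and, for $k\ge 0$, let $T_{2k+1}$ be the first time $t\ge T_{2k}$ such that $B_t-\sup_{T_{2k}\le s\le t}B_s=-2c$, and $T_{2k+2}$ the first time $t\ge T_{2k+1}$ such that $B_t-\inf_{T_{2k+1}\le s\le t}B_s=2c$. Put $U_t=0$ for $0\le t\le T_0$, $U_t=\sup_{T_{2k}\le s\le t}B_s-c$ for $T_{2k}<t\le T_{2k+1}$, and $U_t=\inf_{T_{2k+1}\le s\le t}B_s+c$ for $T_{2k+1}<t\le T_{2k+2}$. Otherwise, let $T_0=\inf\{t\ge 0: B_t=-c\}$ and, for $k\ge 0$, let $T_{2k+1}$ be the first time $t\ge T_{2k}$ such that $B_t-\inf_{T_{2k}\le s\le t}B_s=2c$, and $T_{2k+2}$ the first time $t\ge T_{2k+1}$ such that $B_t-\sup_{T_{2k+1}\le s\le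 t}B_s=-2c$. Put $U_t=0$ for $0\le t\le T_0$, $U_t=\inf_{T_{2k}\le s\le t}B_s+c$ for $T_{2k}<t\le T_{2k+1}$, and $U_t=\sup_{T_{2k+1}\le s\le t}B_s-c$ for $T_{2k+1}<t\le T_{2k+2}$. (At any time not covered by these clauses, put $U_t=0$.) Then almost surely $T_m<\infty$ for all $m\ge 0$; each $U_t$ is a random variable (measurable up to a null set); and, up to indistinguishability, $U$ is the only process that almost surely has continuous paths of finite variation on compact intervals and satisfies: (a) $U_0=0$; (b) $B_t-c\le U_t\le B_t+c$ for all $t\ge 0$; (c) $U$ is nondecreasing on every interval on which it remains strictly smaller than $B+c$; (d) $U$ is nonincreasing on every interval on which it remains strictly larger than $B-c$. That is, $U$ has these properties almost surely, and every process $V$ that has them almost surely satisfies $V_t=U_t$ for all $t\ge 0$, almost surely. -/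

import Mathlib

open scoped NNReal ENNReal

namespace AMM

/-- The infimum of a set of times, as an extended time (`⊤` if the set is empty). -/
noncomputable def firstTime (S : Set ℝ≥0) : ℝ≥0∞ :=
  sInf ((fun t : ℝ≥0 => (t : ℝ≥0∞)) '' S)

/-- `sup_{a ≤ s ≤ t} b s`. -/
noncomputable def runSup (b : ℝ≥0 → ℝ) (a : ℝ≥0∞) (t : ℝ≥0) : ℝ :=
  sSup (b '' {s : ℝ≥0 | a ≤ (s : ℝ≥0∞) ∧ s ≤ t})

/-- `inf_{a ≤ s ≤ t} b s`. -/
noncomputable def runInf (b : ℝ≥0 → ℝ) (a : ℝ≥0∞) (t : ℝ≥0) : ℝ :=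
  sInf (b '' {s : ℝ≥0 | a ≤ (s : ℝ≥0∞) ∧ s ≤ t})

/-- The path `b` reaches `c` before `-c`. -/
def UpperFirst (b : ℝ≥0 → ℝ) (c : ℝ) : Prop :=
  firstTime {t | b t = c} < firstTime {t | b t = -c}

/-- The `m`-th phase, between the `m`-th and the `(m+1)`-st switching times, is one of running
suprema: if `b` reaches `c` before `-c`, these are the phases with `m` even; otherwise they are
those with `m` odd. All other phases are of running infima. -/
def SupPhase (b : ℝ≥0 → ℝ) (c : ℝ) (m : ℕ) : Prop :=
  UpperFirst b c ↔ Even m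

open Classical in
/-- The switching times. The initial one is the first time at which `b` reaches `c` or `-c`,
whichever comes first. A phase of running suprema ends when `b` is `2c` below its supremum since
the start of the phase, a phase of running infima ends when `b` is `2c` above its infimum since
the start of the phase. -/
noncomputable def switchTime (b : ℝ≥0 → ℝ) (c : ℝ) : ℕ → ℝ≥0∞
  | 0 => if UpperFirst b c then firstTime {t | b t = c} else firstTime {t | b t = -c}
  | m + 1 =>
      if SupPhase b c m then
        firstTime {t : ℝ≥0 | switchTime b c m ≤ (t : ℝ≥0∞) ∧
          b t - runSup b (switchTime b c m) t = -(2 * c)}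
      else
        firstTime {t : ℝ≥0 | switchTime b c m ≤ (t : ℝ≥0∞) ∧
          b t - runInf b (switchTime b c m) t = 2 * c}

open Classical in
/-- The log AMM price path built from the log market price path `b`: zero up to the initial
switching time, then, in the `m`-th phase, running supremum minus `c` or running infimum plus `c`.
The switching times are nondecreasing, so the phase that contains `t` is unique. -/
noncomputable def logPrice (b : ℝ≥0 → ℝ) (c : ℝ) (t : ℝ≥0) : ℝ :=
  if h : ∃ m : ℕ, switchTime b c m < (t : ℝ≥0∞) ∧ (t : ℝ≥0∞) ≤ switchTime b c (m + 1) then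
    if SupPhase b c (Nat.find h) then
      runSup b (switchTime b c (Nat.find h)) t - c
    else
      runInf b (switchTime b c (Nat.find h)) t + c
  else 0

/-- The path `u` is continuous, of finite variation on every compact interval, starts at `0`,
stays within distance `c` of `b`, is nondecreasing on every interval where it remains strictly
below `b + c`, and nonincreasing on every interval where it remains strictly above `b - c`. -/
structure IsReflectedPath (b : ℝ≥0 → ℝ) (c : ℝ) (u : ℝ≥0 → ℝ) : Prop where
  continuous : Continuous u
  finiteVariation : LocallyBoundedVariationOn u Set.univ
  zero : u 0 = 0
  bounds : ∀ t, b t - c ≤ u t ∧ u t ≤ b t + c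
  monotoneOn : ∀ I : Set ℝ≥0, I.OrdConnected → (∀ t ∈ I, u t < b t + c) → MonotoneOn u I
  antitoneOn : ∀ I : Set ℝ≥0, I.OrdConnected → (∀ t ∈ I, b t - c < u t) → AntitoneOn u I

end AMM

/-! Apart from measurability, the argument is pathwise. For continuous `b`, a reflected path can
fall below a level only if `b + c` forces it, and rise above one only if `b - c` does. So
`IsReflectedPath.le_iff` expresses `a ≤ u t` through `b` alone, which gives uniqueness; restricted
to a countable dense set of times, it also gives measurability.

For existence, a running supremum minus `c` increases only when it touches `b - c`, and stays below
`b + c` until the drawdown reaches `2c` (`isReflectedOn_runSup_sub`). Infimum phases follow by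
changing sign, and consecutive phases agree at the switching times. These times cannot accumulate,
since `b` moves by `2c` in each phase (`IsSwitchSeq.exists_lt`).

Probability enters the construction through `ae_oscillates`: by the second Borel–Cantelli lemma,
unit increments beyond `±2c` recur forever, so every switching time is finite. -/

namespace ProbabilityTheory

open MeasureTheory Filter

/-! ### Recurrence of large Brownian increments -/

/-- Almost surely, infinitely many unit increments of a Brownian motion fall into a given set of
positive Lebesgue measure. -/
theorem IsBrownianReal.ae_frequently_increment_mem {Ω : Type*} [MeasurableSpace Ω] {P : Measure Ω}
    {B : ℝ≥0 → Ω → ℝ} (hB : IsBrownianReal B P) {S : Set ℝ} (hS : MeasurableSet S)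
    (hvol : volume S ≠ 0) :
    ∀ᵐ ω ∂P, ∃ᶠ n : ℕ in atTop, B ((n + 1 : ℕ) : ℝ≥0) ω - B (n : ℝ≥0) ω ∈ S := by
  have hP : IsProbabilityMeasure P := hB.isGaussianProcess.isProbabilityMeasure
  have hmeas : ∀ n : ℕ, AEMeasurable (fun ω => B ((n + 1 : ℕ) : ℝ≥0) ω - B (n : ℝ≥0) ω) P :=
    fun n => (hB.aemeasurable _).sub (hB.aemeasurable _)
  -- The increments are only a.e. measurable; Borel–Cantelli needs measurable events, hence the
  -- modifications.
  have hind : iIndepFun (fun n : ℕ => (hmeas n).mk) P :=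
    (hB.hasIndepIncrements.nat (t := fun n : ℕ => (n : ℝ≥0)) Nat.mono_cast).congr
      fun n => (hmeas n).ae_eq_mk
  have hE : ∀ n, MeasurableSet ((hmeas n).mk ⁻¹' S) := fun n => (hmeas n).measurable_mk hS
  have hset : iIndepSet (fun n => (hmeas n).mk ⁻¹' S) P :=
    (iIndepSet_iff_meas_biInter hE).2 fun s =>
      hind.measure_inter_preimage_eq_mul s fun _ _ => hS
  have hprob : ∀ n, P ((hmeas n).mk ⁻¹' S) = gaussianReal 0 1 S := by
    intro n
    have h1 : P ((hmeas n).mk ⁻¹' S) =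
        P ((B ((n + 1 : ℕ) : ℝ≥0) - B (n : ℝ≥0)) ⁻¹' S) := by
      refine measure_congr ?_
      filter_upwards [(hmeas n).ae_eq_mk] with ω hω
      change (_ ∈ S) = (_ ∈ S)
      rw [← hω]; rfl
    have hlaw := hB.hasLaw_sub ((n + 1 : ℕ) : ℝ≥0) (n : ℝ≥0)
    rw [h1, ← Measure.map_apply_of_aemeasurable hlaw.aemeasurable hS, hlaw.map_eq]
    congr 2
    ext
    simp
  have hpos : gaussianReal 0 1 S ≠ 0 :=
    fun h => hvol (gaussianReal_absolutelyContinuous' 0 one_ne_zero h)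
  have hlim := measure_limsup_eq_one hE hset (by
    simp_rw [hprob]; exact ENNReal.tsum_const_eq_top_of_ne_zero hpos)
  have hae : ∀ᵐ ω ∂P, ω ∈ limsup (fun n => (hmeas n).mk ⁻¹' S) atTop := by
    refine (prob_compl_eq_zero_iff (MeasurableSet.measurableSet_limsup hE)).2 hlim
  filter_upwards [hae, ae_all_iff.2 fun n => (hmeas n).ae_eq_mk] with ω h1 h2
  refine (mem_limsup_iff_frequently_mem.1 h1).mono fun n hn => ?_
  rw [h2 n]; exact hn

end ProbabilityTheory

/-! ### Uniqueness and measurability of reflected paths -/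

namespace AMM

open Set

variable {b u : ℝ≥0 → ℝ} {c : ℝ}

/-- A reflected path stays above a level below which it cannot be pushed. -/
theorem IsReflectedPath.le_of_le (h : IsReflectedPath b c u) {s t : ℝ≥0} (hst : s ≤ t) {a : ℝ}
    (hs : a ≤ u s) (hupper : ∀ x ∈ Icc s t, a ≤ b x + c) : a ≤ u t := by
  by_contra! hlt
  -- Take the last time `r` with `a ≤ u r`. After it `u < a ≤ b + c`, so `u` cannot decrease from
  -- `r` to `t`.
  obtain ⟨r, ⟨⟨hsr, hrt⟩, har⟩, hr⟩ :=
    (isCompact_Icc.inter_right (isClosed_le continuous_const h.continuous)).exists_isGreatest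
      (s := Icc s t ∩ {x | a ≤ u x}) ⟨s, ⟨le_rfl, hst⟩, hs⟩
  have har' : a ≤ u r := har
  have hrt' : r < t := hrt.lt_of_ne (by rintro rfl; linarith)
  have hbelow : ∀ x ∈ Ioc r t, u x < b x + c := by
    intro x hx
    refine lt_of_lt_of_le ?_ (hupper x ⟨hsr.trans hx.1.le, hx.2⟩)
    by_contra! hax
    exact hx.1.not_ge (hr ⟨⟨hsr.trans hx.1.le, hx.2⟩, hax⟩)
  have hmono := h.monotoneOn _ ordConnected_Ioc hbelow
  have hsub : Icc r t ⊆ {x | u x ≤ u t} := by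
    rw [← closure_Ioc hrt'.ne]
    exact closure_minimal (fun x hx => hmono hx ⟨hrt', le_rfl⟩ hx.2)
      (isClosed_le h.continuous continuous_const)
  have : u r ≤ u t := hsub ⟨le_rfl, hrt⟩
  linarith

/-- The superlevel sets of the value at time `t` of a reflected path, in terms of the path by which
it is driven. -/
theorem IsReflectedPath.le_iff (hb : Continuous b) (h : IsReflectedPath b c u) {t : ℝ≥0} {a : ℝ} :
    a ≤ u t ↔ (a ≤ 0 ∧ ∀ x ≤ t, a ≤ b x + c) ∨
      ∃ s ≤ t, a ≤ b s - c ∧ ∀ x ∈ Icc s t, a ≤ b x + c := by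
  constructor
  · intro ha
    -- Split on whether `u` touches `b - c` before `t`. After the last contact, or from `0` if there
    -- is none, `u` is nonincreasing, so its earlier values dominate `u t`.
    rcases (Icc 0 t ∩ {x | u x ≤ b x - c}).eq_empty_or_nonempty with he | hne
    · have hanti := h.antitoneOn (Icc 0 t) ordConnected_Icc fun x hx => by
        by_contra! hle
        exact (he ▸ (⟨hx, hle⟩ : x ∈ Icc 0 t ∩ {x | u x ≤ b x - c}) : x ∈ (∅ : Set ℝ≥0))
      have hle : ∀ x ≤ t, a ≤ u x := fun x hx =>
        ha.trans (hanti ⟨zero_le, hx⟩ ⟨zero_le, le_rfl⟩ hx)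
      exact Or.inl ⟨h.zero ▸ hle 0 zero_le, fun x hx => (hle x hx).trans (h.bounds x).2⟩
    · obtain ⟨r, ⟨⟨-, hrt⟩, hur⟩, hr⟩ :=
        (isCompact_Icc.inter_right (isClosed_le h.continuous
          (hb.sub continuous_const))).exists_isGreatest hne
      have habove : ∀ x ∈ Ioc r t, b x - c < u x := by
        intro x hx
        by_contra! hle
        exact hx.1.not_ge (hr ⟨⟨zero_le, hx.2⟩, hle⟩)
      have hanti := h.antitoneOn _ ordConnected_Ioc habove
      have hsub : Icc r t ⊆ {x | u t ≤ u x} := by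
        rcases hrt.eq_or_lt with rfl | hrt'
        · rw [Icc_self]; rintro x rfl; exact le_refl (u x)
        · rw [← closure_Ioc hrt'.ne]
          exact closure_minimal (fun x hx => hanti hx ⟨hrt', le_rfl⟩ hx.2)
            (isClosed_le continuous_const h.continuous)
      exact Or.inr ⟨r, hrt, ha.trans ((hsub ⟨le_rfl, hrt⟩).trans hur), fun x hx =>
        ha.trans ((hsub hx).trans (h.bounds x).2)⟩
  · rintro (⟨ha, hup⟩ | ⟨s, hst, ha, hup⟩)
    · exact h.le_of_le zero_le (h.zero.symm ▸ ha) fun x hx => hup x hx.2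
    · exact h.le_of_le hst (ha.trans (h.bounds s).1) hup

theorem IsReflectedPath.unique (hb : Continuous b) (h : IsReflectedPath b c u) {v : ℝ≥0 → ℝ}
    (hv : IsReflectedPath b c v) : v = u :=
  funext fun _ => le_antisymm ((h.le_iff hb).2 ((hv.le_iff hb).1 le_rfl))
    ((hv.le_iff hb).2 ((h.le_iff hb).1 le_rfl))

theorem forall_Icc_le_of_dense {f : ℝ≥0 → ℝ} (hf : Continuous f) {D : Set ℝ≥0} (hD : Dense D)
    {s t : ℝ≥0} {a : ℝ} (ht : a ≤ f t) (h : ∀ x ∈ D, s ≤ x → x ≤ t → a ≤ f x) :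
    ∀ x ∈ Icc s t, a ≤ f x := by
  intro x hx
  rcases (hx.1.trans hx.2).eq_or_lt with rfl | hst
  · rwa [le_antisymm hx.2 hx.1]
  · have hsub : Icc s t ⊆ {x | a ≤ f x} := by
      rw [← closure_Ioo hst.ne]
      refine closure_minimal ((hD.open_subset_closure_inter isOpen_Ioo).trans
        (closure_minimal ?_ ?_)) ?_
      · exact fun y hy => h y hy.2 hy.1.1.le hy.1.2.le
      all_goals exact isClosed_le continuous_const hf
    exact hsub hx

/-- A rational strictly between `a` and `u t` leaves room to move the witness `s` of `le_iff` to the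
right into `D`, which only weakens the constraint on `[s, t]`. When `s = t` there is no such room,
hence `t ∈ D`. -/
theorem IsReflectedPath.lt_iff_dense (hb : Continuous b) (h : IsReflectedPath b c u)
    {D : Set ℝ≥0} (hD : Dense D) {t : ℝ≥0} (htD : t ∈ D) {a : ℝ} :
    a < u t ↔ ∃ q : ℚ, a < q ∧ (((q : ℝ) ≤ 0 ∧ ∀ x : D, x ≤ t → (q : ℝ) ≤ b x + c) ∨
      ∃ s : D, s ≤ t ∧ (q : ℝ) ≤ b s - c ∧
        ∀ x : D, (s : ℝ≥0) ≤ x → x ≤ t → (q : ℝ) ≤ b x + c) := by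
  constructor
  · intro ha
    obtain ⟨q, haq, hqu⟩ := exists_rat_btwn ha
    refine ⟨q, haq, ?_⟩
    rcases (h.le_iff hb).1 (le_refl (u t)) with ⟨h0, hup⟩ | ⟨s, hst, hs, hup⟩
    · exact Or.inl ⟨hqu.le.trans h0, fun x hx => hqu.le.trans (hup x hx)⟩
    · right
      rcases hst.eq_or_lt with rfl | hst'
      · exact ⟨⟨s, htD⟩, le_rfl, hqu.le.trans hs, fun x h1 h2 => hqu.le.trans (hup x ⟨h1, h2⟩)⟩
      · have hopen : IsOpen {x | (q : ℝ) < b x - c} :=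
          isOpen_lt continuous_const (hb.sub continuous_const)
        have hcl : s ∈ closure (Ioo s t) := by
          rw [closure_Ioo hst'.ne]; exact ⟨le_rfl, hst⟩
        have hne := mem_closure_iff.1 hcl _ hopen (hqu.trans_le hs)
        obtain ⟨y, ⟨hy, hsy, hyt⟩, hyD⟩ := hD.inter_open_nonempty _ (hopen.inter isOpen_Ioo) hne
        exact ⟨⟨y, hyD⟩, hyt.le, le_of_lt hy, fun x h1 h2 =>
          hqu.le.trans (hup x ⟨hsy.le.trans h1, h2⟩)⟩
  · rintro ⟨q, haq, hq⟩
    refine haq.trans_le ((h.le_iff hb).2 ?_)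
    have hbc : Continuous fun x => b x + c := hb.add continuous_const
    rcases hq with ⟨h0, hup⟩ | ⟨s, hst, hs, hup⟩
    · exact Or.inl ⟨h0, fun x hx => forall_Icc_le_of_dense (s := 0) hbc hD
        (hup ⟨t, htD⟩ le_rfl) (fun y hy _ hyt => hup ⟨y, hy⟩ hyt) x ⟨zero_le, hx⟩⟩
    · exact Or.inr ⟨s, hst, hs, forall_Icc_le_of_dense hbc hD
        (hup ⟨t, htD⟩ hst le_rfl) fun y hy hsy hyt => hup ⟨y, hy⟩ hsy hyt⟩

open MeasureTheory in
/-- The values of a process with reflected paths are measurable if those of the driving process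
are. -/
theorem aemeasurable_of_isReflectedPath {Ω : Type*} [MeasurableSpace Ω] {P : Measure Ω}
    {B U : ℝ≥0 → Ω → ℝ} (hB : ∀ t, AEMeasurable (B t) P)
    (hcont : ∀ᵐ ω ∂P, Continuous fun t => B t ω)
    (hU : ∀ᵐ ω ∂P, IsReflectedPath (fun t => B t ω) c (fun t => U t ω)) (t : ℝ≥0) :
    AEMeasurable (U t) P := by
  obtain ⟨D₀, hD₀c, hD₀⟩ := TopologicalSpace.exists_countable_dense ℝ≥0
  set D := insert t D₀
  have hD : Dense D := hD₀.mono (subset_insert _ _)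
  have : Countable D := (hD₀c.insert t).to_subtype
  have hmk : ∀ᵐ ω ∂P, ∀ x : D, B x ω = (hB x).mk (B x) ω :=
    ae_all_iff.2 fun x => (hB x).ae_eq_mk
  have hmeas : ∀ x : D, Measurable ((hB x).mk (B x)) := fun x => (hB x).measurable_mk
  refine NullMeasurable.aemeasurable (measurable_of_Ioi (δ := NullMeasurableSpace Ω P) fun a => ?_)
  have hset : MeasurableSet {ω | ∃ q : ℚ, a < q ∧
      (((q : ℝ) ≤ 0 ∧ ∀ x : D, x ≤ t → (q : ℝ) ≤ (hB x).mk (B x) ω + c) ∨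
        ∃ s : D, s ≤ t ∧ (q : ℝ) ≤ (hB s).mk (B s) ω - c ∧
          ∀ x : D, (s : ℝ≥0) ≤ x → x ≤ t → (q : ℝ) ≤ (hB x).mk (B x) ω + c)} := by
    have hl : ∀ (q : ℚ) (x : D), Measurable fun ω => (q : ℝ) ≤ (hB x).mk (B x) ω - c :=
      fun q x => measurableSet_setOfPred.1
        (measurableSet_le measurable_const ((hmeas x).sub_const c))
    have hh : ∀ (q : ℚ) (x : D), Measurable fun ω => (q : ℝ) ≤ (hB x).mk (B x) ω + c :=
      fun q x => measurableSet_setOfPred.1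
        (measurableSet_le measurable_const ((hmeas x).add_const c))
    refine measurableSet_setOfPred.2 (Measurable.exists fun q => measurable_const.and (.or ?_ ?_))
    · exact measurable_const.and (Measurable.forall fun x => measurable_const.imp (hh q x))
    · exact Measurable.exists fun s => measurable_const.and ((hl q s).and
        (Measurable.forall fun x => measurable_const.imp (measurable_const.imp (hh q x))))
  refine hset.nullMeasurableSet.congr ?_
  filter_upwards [hmk, hcont, hU] with ω h1 h2 h3
  refine propext (Iff.trans ?_ (h3.lt_iff_dense h2 hD (mem_insert t D₀)).symm)
  simp only [h1]
  rfl

end AMM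

/-! ### Gluing of reflected paths, and running suprema -/

namespace AMM

open Set

variable {b u : ℝ≥0 → ℝ} {c : ℝ}

/-- The properties of a reflected path, on a set of times. -/
structure IsReflectedOn (b : ℝ≥0 → ℝ) (c : ℝ) (u : ℝ≥0 → ℝ) (K : Set ℝ≥0) : Prop where
  continuousOn : ContinuousOn u K
  finiteVariation : LocallyBoundedVariationOn u K
  bounds : ∀ t ∈ K, b t - c ≤ u t ∧ u t ≤ b t + c
  monotoneOn : ∀ I ⊆ K, I.OrdConnected → (∀ t ∈ I, u t < b t + c) → MonotoneOn u I
  antitoneOn : ∀ I ⊆ K, I.OrdConnected → (∀ t ∈ I, b t - c < u t) → AntitoneOn u I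

theorem locallyBoundedVariationOn_neg {K : Set ℝ≥0} (h : LocallyBoundedVariationOn u K) :
    LocallyBoundedVariationOn (-u) K := by
  intro x y hx hy
  have := h x y hx hy
  unfold BoundedVariationOn eVariationOn at this ⊢
  simpa only [Pi.neg_apply, edist_neg_neg] using this

theorem IsReflectedOn.neg {K : Set ℝ≥0} (h : IsReflectedOn b c u K) :
    IsReflectedOn (-b) c (-u) K where
  continuousOn := h.continuousOn.neg
  finiteVariation := locallyBoundedVariationOn_neg h.finiteVariation
  bounds t ht := by
    have := h.bounds t ht
    simp only [Pi.neg_apply]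
    constructor <;> linarith
  monotoneOn I hIK hI hlt := (h.antitoneOn I hIK hI fun t ht => by
    have := hlt t ht
    simp only [Pi.neg_apply] at this
    linarith).neg
  antitoneOn I hIK hI hlt := (h.monotoneOn I hIK hI fun t ht => by
    have := hlt t ht
    simp only [Pi.neg_apply] at this
    linarith).neg

theorem IsReflectedOn.congr {K : Set ℝ≥0} {v : ℝ≥0 → ℝ} (h : IsReflectedOn b c u K)
    (huv : EqOn v u K) : IsReflectedOn b c v K where
  continuousOn := h.continuousOn.congr huv
  finiteVariation x y hx hy := by
    have := h.finiteVariation x y hx hy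
    unfold BoundedVariationOn at this ⊢
    rwa [eVariationOn.congr (huv.mono inter_subset_left)]
  bounds t ht := by rw [huv ht]; exact h.bounds t ht
  monotoneOn I hIK hI hlt := (h.monotoneOn I hIK hI fun t ht => by
    rw [← huv (hIK ht)]; exact hlt t ht).congr (huv.mono hIK).symm
  antitoneOn I hIK hI hlt := (h.antitoneOn I hIK hI fun t ht => by
    rw [← huv (hIK ht)]; exact hlt t ht).congr (huv.mono hIK).symm

theorem monotoneOn_of_inter_Icc {I : Set ℝ≥0} (hI : I.OrdConnected) {x y z : ℝ≥0}
    (hIK : I ⊆ Icc x z) (h₁ : MonotoneOn u (I ∩ Icc x y)) (h₂ : MonotoneOn u (I ∩ Icc y z)) :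
    MonotoneOn u I := by
  intro s hs t ht hst
  rcases le_total t y with hty | hyt
  · exact h₁ ⟨hs, (hIK hs).1, hst.trans hty⟩ ⟨ht, (hIK ht).1, hty⟩ hst
  rcases le_total y s with hys | hsy
  · exact h₂ ⟨hs, hys, (hIK hs).2⟩ ⟨ht, hyt, (hIK ht).2⟩ hst
  have hy : y ∈ I := hI.out hs ht ⟨hsy, hyt⟩
  exact (h₁ ⟨hs, (hIK hs).1, hsy⟩ ⟨hy, (hIK hy).1, le_rfl⟩ hsy).trans
    (h₂ ⟨hy, le_rfl, (hIK hy).2⟩ ⟨ht, hyt, (hIK ht).2⟩ hyt)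

theorem IsReflectedOn.union_Icc {x y z : ℝ≥0} (hxy : x ≤ y) (hyz : y ≤ z)
    (h₁ : IsReflectedOn b c u (Icc x y)) (h₂ : IsReflectedOn b c u (Icc y z)) :
    IsReflectedOn b c u (Icc x z) where
  continuousOn := by
    rw [← Icc_union_Icc_eq_Icc hxy hyz]
    exact h₁.continuousOn.union_of_isClosed h₂.continuousOn isClosed_Icc isClosed_Icc
  finiteVariation := by
    refine BoundedVariationOn.locallyBoundedVariationOn ?_
    have e₁ := h₁.finiteVariation x y ⟨le_rfl, hxy⟩ ⟨hxy, le_rfl⟩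
    have e₂ := h₂.finiteVariation y z ⟨le_rfl, hyz⟩ ⟨hyz, le_rfl⟩
    have e₃ := eVariationOn.Icc_add_Icc u (s := univ) hxy hyz (mem_univ y)
    simp only [inter_self, univ_inter] at e₁ e₂ e₃
    unfold BoundedVariationOn at *
    rw [← e₃]
    exact ENNReal.add_ne_top.2 ⟨e₁, e₂⟩
  bounds t ht := by
    rcases le_total t y with hty | hyt
    exacts [h₁.bounds t ⟨ht.1, hty⟩, h₂.bounds t ⟨hyt, ht.2⟩]
  monotoneOn I hIK hI hlt := monotoneOn_of_inter_Icc hI hIK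
    (h₁.monotoneOn _ inter_subset_right (hI.inter ordConnected_Icc) fun t ht => hlt t ht.1)
    (h₂.monotoneOn _ inter_subset_right (hI.inter ordConnected_Icc) fun t ht => hlt t ht.1)
  antitoneOn I hIK hI hlt := by
    have := monotoneOn_of_inter_Icc (u := -u) hI hIK
      (h₁.antitoneOn _ inter_subset_right (hI.inter ordConnected_Icc) fun t ht => hlt t ht.1).neg
      (h₂.antitoneOn _ inter_subset_right (hI.inter ordConnected_Icc) fun t ht => hlt t ht.1).neg
    simpa using this.neg

/-- Monotonicity and variation are tested between two times, so compact intervals suffice; the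
strict `t < s` makes `[0, s]` a neighbourhood of `t`. -/
theorem isReflectedPath_of_forall_Icc (h0 : u 0 = 0)
    (h : ∀ t, ∃ s, t < s ∧ IsReflectedOn b c u (Icc 0 s)) : IsReflectedPath b c u where
  continuous := continuous_iff_continuousAt.2 fun t => by
    obtain ⟨s, hts, hs⟩ := h t
    refine hs.continuousOn.continuousAt ?_
    rw [show (0 : ℝ≥0) = ⊥ from rfl, Icc_bot]
    exact Iic_mem_nhds hts
  finiteVariation x y _ _ := by
    obtain ⟨s, hts, hs⟩ := h y
    have := hs.finiteVariation 0 s ⟨le_rfl, zero_le⟩ ⟨zero_le, le_rfl⟩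
    exact this.mono fun t ht => ⟨⟨zero_le, ht.2.2.trans hts.le⟩, zero_le, ht.2.2.trans hts.le⟩
  zero := h0
  bounds t := by
    obtain ⟨s, hts, hs⟩ := h t
    exact hs.bounds t ⟨zero_le, hts.le⟩
  monotoneOn I hI hlt x hx y hy hxy := by
    obtain ⟨s, hts, hs⟩ := h y
    have hsub : Icc x y ⊆ I := hI.out hx hy
    exact hs.monotoneOn (Icc x y) (Icc_subset_Icc zero_le hts.le) ordConnected_Icc
      (fun t ht => hlt t (hsub ht)) ⟨le_rfl, hxy⟩ ⟨hxy, le_rfl⟩ hxy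
  antitoneOn I hI hlt x hx y hy hxy := by
    obtain ⟨s, hts, hs⟩ := h y
    have hsub : Icc x y ⊆ I := hI.out hx hy
    exact hs.antitoneOn (Icc x y) (Icc_subset_Icc zero_le hts.le) ordConnected_Icc
      (fun t ht => hlt t (hsub ht)) ⟨le_rfl, hxy⟩ ⟨hxy, le_rfl⟩ hxy

theorem runInf_eq_neg_runSup_neg (b : ℝ≥0 → ℝ) (a : ℝ≥0∞) (t : ℝ≥0) :
    runInf b a t = -runSup (-b) a t := by
  unfold runInf runSup
  rw [Real.sInf_def, ← image_neg_eq_neg, image_image]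
  rfl

theorem runSup_coe (b : ℝ≥0 → ℝ) (a t : ℝ≥0) : runSup b a t = sSup (b '' Icc a t) := by
  simp only [runSup, ENNReal.coe_le_coe]
  rfl

theorem le_runSup (hb : Continuous b) {a s t : ℝ≥0} (has : a ≤ s) (hst : s ≤ t) :
    b s ≤ runSup b a t := by
  rw [runSup_coe]
  exact le_csSup (isCompact_Icc.image hb).bddAbove (mem_image_of_mem b ⟨has, hst⟩)

theorem exists_eq_runSup (hb : Continuous b) {a t : ℝ≥0} (hat : a ≤ t) :
    ∃ s ∈ Icc a t, b s = runSup b a t := by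
  rw [runSup_coe]
  exact (isCompact_Icc.image hb).sSup_mem ((nonempty_Icc.2 hat).image b)

theorem runSup_self (b : ℝ≥0 → ℝ) (a : ℝ≥0) : runSup b a a = b a := by
  rw [runSup_coe]; simp

theorem monotoneOn_runSup (hb : Continuous b) (a : ℝ≥0) : MonotoneOn (runSup b a) (Ici a) := by
  intro s hs t _ hst
  obtain ⟨r, hr, hr'⟩ := exists_eq_runSup hb (mem_Ici.1 hs)
  rw [← hr']
  exact le_runSup hb hr.1 (hr.2.trans hst)

theorem continuousOn_runSup (hb : Continuous b) (a : ℝ≥0) :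
    ContinuousOn (runSup b a) (Ici a) := by
  -- Rescaling `[a, t]` to `[0, 1]` turns this into a supremum over a fixed compact set.
  have hcont : Continuous fun t : ℝ≥0 =>
      sSup ((fun s => b (a + s * (t - a))) '' Icc (0 : ℝ≥0) 1) :=
    isCompact_Icc.continuous_sSup (f := fun t s : ℝ≥0 => b (a + s * (t - a))) (by
      simp only [Function.HasUncurry.uncurry]
      fun_prop)
  refine hcont.continuousOn.congr fun t ht => ?_
  rw [runSup_coe]
  congr 1
  ext y
  simp only [mem_image, mem_Icc]
  constructor
  · rintro ⟨x, ⟨hax, hxt⟩, rfl⟩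
    rcases (mem_Ici.1 ht).eq_or_lt with rfl | hat
    · exact ⟨0, by simp, by simp [le_antisymm hxt hax]⟩
    · have hpos : 0 < t - a := tsub_pos_of_lt hat
      refine ⟨(x - a) / (t - a), ⟨zero_le, ?_⟩, ?_⟩
      · rw [div_le_one hpos]; exact tsub_le_tsub_right hxt a
      · rw [div_mul_cancel₀ _ hpos.ne', add_tsub_cancel_of_le hax]
  · rintro ⟨s, ⟨-, hs⟩, rfl⟩
    refine ⟨a + s * (t - a), ⟨le_self_add, ?_⟩, rfl⟩
    calc a + s * (t - a) ≤ a + 1 * (t - a) := by gcongr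
      _ = t := by rw [one_mul, add_tsub_cancel_of_le ht]

/-- The bounds say that the drawdown lies in `[-2c, 0]`. If the supremum grew on an interval, it
would be attained there by `b`, and the path would touch `b - c`. -/
theorem isReflectedOn_runSup_sub (hb : Continuous b) {a T : ℝ≥0}
    (hdraw : ∀ t ∈ Icc a T, -(2 * c) ≤ b t - runSup b a t) :
    IsReflectedOn b c (fun t => runSup b a t - c) (Icc a T) where
  continuousOn := ((continuousOn_runSup hb a).sub continuousOn_const).mono Icc_subset_Ici_self
  finiteVariation := by
    refine MonotoneOn.locallyBoundedVariationOn fun s hs t ht hst => ?_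
    exact sub_le_sub_right (monotoneOn_runSup hb a hs.1 ht.1 hst) c
  bounds t ht := by
    have h₁ := hdraw t ht
    have h₂ := le_runSup hb ht.1 le_rfl
    constructor <;> linarith
  monotoneOn I hIK _ _ s hs t ht hst :=
    sub_le_sub_right (monotoneOn_runSup hb a (hIK hs).1 (hIK ht).1 hst) c
  antitoneOn I hIK hI hlt s hs t ht hst := by
    obtain ⟨r, hr, hr'⟩ := exists_eq_runSup hb (hIK ht).1
    refine sub_le_sub_right ?_ c
    rcases le_total r s with hrs | hsr
    · rw [← hr']; exact le_runSup hb hr.1 hrs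
    · have h₁ := hlt r (hI.out hs ht ⟨hsr, hr.2⟩)
      have h₂ := monotoneOn_runSup hb a hr.1 (hIK ht).1 hr.2
      linarith

theorem isReflectedOn_zero {K : Set ℝ≥0} (h : ∀ t ∈ K, |b t| ≤ c) :
    IsReflectedOn b c (fun _ => 0) K where
  continuousOn := continuousOn_const
  finiteVariation := monotoneOn_const.locallyBoundedVariationOn
  bounds t ht := by
    have := abs_le.1 (h t ht)
    constructor <;> linarith
  monotoneOn _ _ _ _ := monotoneOn_const
  antitoneOn _ _ _ _ := antitoneOn_const

end AMM

/-! ### Switching times and the path built from them -/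

namespace AMM

open Set

variable {b u : ℝ≥0 → ℝ} {c : ℝ}

theorem firstTime_eq_of_isLeast {S : Set ℝ≥0} {t : ℝ≥0} (h : IsLeast S t) : firstTime S = t :=
  (IsLeast.csInf_eq ⟨mem_image_of_mem _ h.1, by
    rintro _ ⟨s, hs, rfl⟩
    exact ENNReal.coe_le_coe.2 (h.2 hs)⟩ : sInf _ = _)

theorem exists_isLeast_of_isClosed {S : Set ℝ≥0} (hS : IsClosed S) (hne : S.Nonempty) :
    ∃ t, IsLeast S t :=
  ⟨_, hS.isLeast_csInf hne (OrderBot.bddBelow S)⟩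

theorem exists_first_drawdown (hb : Continuous b) (hc : 0 < c) {a : ℝ≥0}
    (h : ∃ t, a ≤ t ∧ b t - runSup b a t ≤ -(2 * c)) :
    ∃ T, IsLeast {t | a ≤ t ∧ b t - runSup b a t = -(2 * c)} T ∧ a < T ∧
      ∀ t ∈ Icc a T, -(2 * c) ≤ b t - runSup b a t := by
  have hcont : ContinuousOn (fun t => b t - runSup b a t) (Ici a) :=
    hb.continuousOn.sub (continuousOn_runSup hb a)
  have hivt : ∀ t, a ≤ t → b t - runSup b a t ≤ -(2 * c) →
      ∃ s ∈ Icc a t, b s - runSup b a s = -(2 * c) := fun t hat ht =>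
    intermediate_value_Icc' hat (hcont.mono Icc_subset_Ici_self) ⟨ht, by
      simp only [runSup_self, sub_self]; linarith⟩
  have hclosed : IsClosed {t | a ≤ t ∧ b t - runSup b a t = -(2 * c)} :=
    hcont.preimage_isClosed_of_isClosed isClosed_Ici (isClosed_singleton (x := -(2 * c)))
  obtain ⟨t, hat, ht⟩ := h
  obtain ⟨s, hs, hs'⟩ := hivt t hat ht
  obtain ⟨T, hT⟩ := exists_isLeast_of_isClosed hclosed ⟨s, hs.1, hs'⟩
  refine ⟨T, hT, hT.1.1.lt_of_ne ?_, fun r hr => ?_⟩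
  · rintro rfl
    have := hT.1.2
    rw [runSup_self] at this
    linarith
  -- A drawdown beyond `2c` at `r` is preceded by one of exactly `2c`, which forces `r = T`.
  · by_contra! hlt
    obtain ⟨s, hs, hs'⟩ := hivt r hr.1 hlt.le
    have hTs : T ≤ s := hT.2 ⟨hs.1, hs'⟩
    have : s = r := le_antisymm hs.2 (hr.2.trans hTs)
    subst this
    linarith

theorem abs_le_of_isLeast_level (hb : Continuous b) (h0 : b 0 = 0) (hc : 0 < c) {T : ℝ≥0}
    (hu : ∀ s, b s = c → T ≤ s) (hl : ∀ s, b s = -c → T ≤ s) : ∀ t ≤ T, |b t| ≤ c := by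
  intro t ht
  rw [abs_le]
  constructor
  · by_contra! hlt
    obtain ⟨s, hs, hs'⟩ := intermediate_value_Icc' (zero_le (a := t)) hb.continuousOn
      (show -c ∈ Icc (b t) (b 0) from ⟨hlt.le, by linarith⟩)
    have := le_antisymm hs.2 (ht.trans (hl s hs'))
    subst this
    linarith
  · by_contra! hlt
    obtain ⟨s, hs, hs'⟩ := intermediate_value_Icc (zero_le (a := t)) hb.continuousOn
      (show c ∈ Icc (b 0) (b t) from ⟨by linarith, hlt.le⟩)
    have := le_antisymm hs.2 (ht.trans (hu s hs'))
    subst this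
    linarith

open Classical in
/-- `1` in phases of running suprema, `-1` in phases of running infima. -/
noncomputable def phaseSign (b : ℝ≥0 → ℝ) (c : ℝ) (m : ℕ) : ℝ :=
  if SupPhase b c m then 1 else -1

theorem phaseSign_eq_or (b : ℝ≥0 → ℝ) (c : ℝ) (m : ℕ) :
    phaseSign b c m = 1 ∨ phaseSign b c m = -1 := by
  unfold phaseSign; split_ifs <;> simp

theorem phaseSign_succ (b : ℝ≥0 → ℝ) (c : ℝ) (m : ℕ) :
    phaseSign b c (m + 1) = -phaseSign b c m := by
  have : SupPhase b c (m + 1) ↔ ¬SupPhase b c m := by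
    unfold SupPhase; rw [Nat.even_add_one]; tauto
  unfold phaseSign
  by_cases h : SupPhase b c m <;> simp [this, h]

/-- An infimum phase of `b` is a supremum phase of `-b`, so only drawdowns need to be studied. -/
theorem switchTime_succ (b : ℝ≥0 → ℝ) (c : ℝ) (m : ℕ) :
    switchTime b c (m + 1) = firstTime {t : ℝ≥0 | switchTime b c m ≤ (t : ℝ≥0∞) ∧
      (phaseSign b c m • b) t - runSup (phaseSign b c m • b) (switchTime b c m) t =
        -(2 * c)} := by
  rw [switchTime]
  unfold phaseSign
  split_ifs with h
  · simp
  · congr 1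
    ext t
    simp only [runInf_eq_neg_runSup_neg, mem_ofPred_eq, neg_smul, one_smul, Pi.neg_apply]
    refine and_congr_right fun _ => ⟨fun h => by linarith, fun h => by linarith⟩

theorem exists_switchTime_zero (hb : Continuous b) (h0 : b 0 = 0) (hc : 0 < c)
    (h : ∃ t, c ≤ |b t|) :
    ∃ T : ℝ≥0, switchTime b c 0 = T ∧ phaseSign b c 0 * b T = c ∧ ∀ t ≤ T, |b t| ≤ c := by
  have hcl : ∀ a : ℝ, IsClosed {t | b t = a} := fun a => isClosed_eq hb continuous_const
  have hphase : SupPhase b c 0 ↔ UpperFirst b c := by simp [SupPhase]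
  by_cases hU : UpperFirst b c
  · have hne : {t | b t = c}.Nonempty := by
      by_contra hempty
      rw [not_nonempty_iff_eq_empty] at hempty
      unfold UpperFirst at hU
      rw [hempty] at hU
      simp [firstTime] at hU
    obtain ⟨T, hT⟩ := exists_isLeast_of_isClosed (hcl c) hne
    refine ⟨T, ?_, ?_, abs_le_of_isLeast_level hb h0 hc (fun s hs => hT.2 hs) fun s hs => ?_⟩
    · rw [switchTime, if_pos hU, firstTime_eq_of_isLeast hT]
    · rw [phaseSign, if_pos (hphase.2 hU), one_mul]; exact hT.1
    · unfold UpperFirst at hU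
      rw [firstTime_eq_of_isLeast hT] at hU
      exact ENNReal.coe_le_coe.1 (hU.le.trans (sInf_le (mem_image_of_mem _ hs)))
  · have hle : firstTime {t | b t = -c} ≤ firstTime {t | b t = c} := not_lt.1 hU
    -- Otherwise both first times are `⊤` and neither level is reached, against `h` and the
    -- intermediate value theorem.
    have hne : {t | b t = -c}.Nonempty := by
      by_contra hempty
      rw [not_nonempty_iff_eq_empty] at hempty
      rw [hempty] at hle
      simp only [firstTime, image_empty, sInf_empty, top_le_iff] at hle
      obtain ⟨t, ht⟩ := h
      rcases le_abs.1 ht with ht | ht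
      · obtain ⟨s, -, hs⟩ := intermediate_value_Icc (zero_le (a := t)) hb.continuousOn
          (show c ∈ Icc (b 0) (b t) from ⟨by linarith, ht⟩)
        have hs' : firstTime {t | b t = c} ≤ s := sInf_le (mem_image_of_mem _ hs)
        exact ENNReal.coe_ne_top (top_le_iff.1 (hle.symm.trans_le hs'))
      · obtain ⟨s, -, hs⟩ := intermediate_value_Icc' (zero_le (a := t)) hb.continuousOn
          (show -c ∈ Icc (b t) (b 0) from ⟨by linarith, by linarith⟩)
        exact (hempty ▸ (show s ∈ {t | b t = -c} from hs) : s ∈ (∅ : Set ℝ≥0))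
    obtain ⟨T, hT⟩ := exists_isLeast_of_isClosed (hcl (-c)) hne
    refine ⟨T, ?_, ?_, abs_le_of_isLeast_level hb h0 hc (fun s hs => ?_) fun s hs => hT.2 hs⟩
    · rw [switchTime, if_neg hU, firstTime_eq_of_isLeast hT]
    · rw [phaseSign, if_neg (mt hphase.1 hU), show b T = -c from hT.1]; ring
    · rw [firstTime_eq_of_isLeast hT] at hle
      exact ENNReal.coe_le_coe.1 (hle.trans (sInf_le (mem_image_of_mem _ hs)))

/-- From any time on, the path both falls and rises by at least `2c`. -/
def Oscillates (b : ℝ≥0 → ℝ) (c : ℝ) : Prop :=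
  ∀ N : ℝ≥0, (∃ x y, N ≤ x ∧ x ≤ y ∧ b y - b x ≤ -(2 * c)) ∧
    ∃ x y, N ≤ x ∧ x ≤ y ∧ 2 * c ≤ b y - b x

/-- The switching times of `b` are finite and equal to `τ`; this records what `b` does between
them. -/
structure IsSwitchSeq (b : ℝ≥0 → ℝ) (c : ℝ) (τ : ℕ → ℝ≥0) : Prop where
  switchTime_eq : ∀ m, switchTime b c m = τ m
  abs_le : ∀ t ≤ τ 0, |b t| ≤ c
  sign_mul : phaseSign b c 0 * b (τ 0) = c
  lt_succ : ∀ m, τ m < τ (m + 1)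
  drawdown_eq : ∀ m, (phaseSign b c m • b) (τ (m + 1)) -
    runSup (phaseSign b c m • b) (τ m) (τ (m + 1)) = -(2 * c)
  le_drawdown : ∀ m, ∀ t ∈ Icc (τ m) (τ (m + 1)), -(2 * c) ≤
    (phaseSign b c m • b) t - runSup (phaseSign b c m • b) (τ m) t

theorem exists_switchTime_succ (hb : Continuous b) (hc : 0 < c) (hosc : Oscillates b c) {m : ℕ}
    {a : ℝ≥0} (ha : switchTime b c m = a) :
    ∃ T : ℝ≥0, switchTime b c (m + 1) = T ∧ a < T ∧
      (phaseSign b c m • b) T - runSup (phaseSign b c m • b) a T = -(2 * c) ∧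
      ∀ t ∈ Icc a T, -(2 * c) ≤ (phaseSign b c m • b) t - runSup (phaseSign b c m • b) a t := by
  have hcont : Continuous (phaseSign b c m • b) := hb.const_smul _
  obtain ⟨x, y, hax, hxy, hdiff⟩ : ∃ x y, a ≤ x ∧ x ≤ y ∧
      (phaseSign b c m • b) y - (phaseSign b c m • b) x ≤ -(2 * c) := by
    rcases phaseSign_eq_or b c m with h | h
    · simpa [h] using (hosc a).1
    · obtain ⟨x, y, h₁, h₂, h₃⟩ := (hosc a).2
      refine ⟨x, y, h₁, h₂, ?_⟩
      simp only [h, neg_smul, one_smul, Pi.neg_apply]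
      linarith
  obtain ⟨T, hT, haT, hdraw⟩ := exists_first_drawdown hcont hc (a := a)
    ⟨y, hax.trans hxy, by linarith [le_runSup hcont hax hxy]⟩
  refine ⟨T, ?_, haT, hT.1.2, hdraw⟩
  rw [switchTime_succ, ha]
  simp only [ENNReal.coe_le_coe]
  exact firstTime_eq_of_isLeast hT

theorem exists_isSwitchSeq (hb : Continuous b) (h0 : b 0 = 0) (hc : 0 < c)
    (hosc : Oscillates b c) : ∃ τ, IsSwitchSeq b c τ := by
  -- A rise of `2c` does not fit strictly between `-c` and `c`.
  obtain ⟨T₀, hT₀, hsign, habs⟩ := exists_switchTime_zero hb h0 hc (by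
    by_contra! hlt
    obtain ⟨x, y, -, -, h⟩ := (hosc 0).2
    have := abs_lt.1 (hlt x)
    have := abs_lt.1 (hlt y)
    linarith)
  have hfin : ∀ m, ∃ T : ℝ≥0, switchTime b c m = T := by
    intro m
    induction m with
    | zero => exact ⟨T₀, hT₀⟩
    | succ m ih =>
      obtain ⟨a, ha⟩ := ih
      obtain ⟨T, hT, -⟩ := exists_switchTime_succ hb hc hosc ha
      exact ⟨T, hT⟩
  choose τ hτ using hfin
  have hτ0 : τ 0 = T₀ := ENNReal.coe_injective ((hτ 0).symm.trans hT₀)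
  have hstep : ∀ m, τ m < τ (m + 1) ∧ _ ∧ _ := fun m => by
    obtain ⟨T, hT, h⟩ := exists_switchTime_succ hb hc hosc (hτ m)
    obtain rfl : τ (m + 1) = T := ENNReal.coe_injective ((hτ (m + 1)).symm.trans hT)
    exact h
  exact ⟨τ, hτ, hτ0 ▸ habs, hτ0 ▸ hsign, fun m => (hstep m).1, fun m => (hstep m).2.1,
    fun m => (hstep m).2.2⟩

namespace IsSwitchSeq

variable {τ : ℕ → ℝ≥0}

theorem strictMono (h : IsSwitchSeq b c τ) : StrictMono τ := strictMono_nat_of_lt_succ h.lt_succ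

-- If the times stayed bounded they would converge. Each phase contains a maximiser of the signed
-- path that differs from its end value by `2c`; both points tend to the same limit, against
-- continuity.
open Filter in
theorem exists_lt (h : IsSwitchSeq b c τ) (hb : Continuous b) (hc : 0 < c) (t : ℝ≥0) :
    ∃ m, t < τ m := by
  by_contra! hle
  have hlim := tendsto_atTop_ciSup h.strictMono.monotone ⟨t, by rintro _ ⟨m, rfl⟩; exact hle m⟩
  have hlim' := hlim.comp (tendsto_add_atTop_nat 1)
  have hosc : ∀ m, ∃ s ∈ Icc (τ m) (τ (m + 1)), |b (τ (m + 1)) - b s| = 2 * c := by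
    intro m
    obtain ⟨s, hs, hs'⟩ := exists_eq_runSup (hb.const_smul (phaseSign b c m)) (h.lt_succ m).le
    have hd := h.drawdown_eq m
    rw [← hs'] at hd
    refine ⟨s, hs, ?_⟩
    rw [abs_eq (by positivity)]
    rcases phaseSign_eq_or b c m with h | h <;>
      simp only [h, neg_smul, one_smul, Pi.neg_apply] at hd
    · right; linarith
    · left; linarith
  choose s hs hs' using hosc
  have hslim := tendsto_of_tendsto_of_tendsto_of_le_of_le hlim hlim' (fun m => (hs m).1)
    fun m => (hs m).2
  have hzero := (((hb.tendsto _).comp hlim').sub ((hb.tendsto _).comp hslim)).abs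
  have hconst := tendsto_nhds_unique (tendsto_const_nhds.congr fun m => (hs' m).symm) hzero
  rw [sub_self, abs_zero] at hconst
  linarith

theorem logPrice_eq_zero (h : IsSwitchSeq b c τ) {t : ℝ≥0} (ht : t ≤ τ 0) :
    logPrice b c t = 0 := by
  refine dif_neg ?_
  rintro ⟨m, hm, -⟩
  rw [h.switchTime_eq, ENNReal.coe_lt_coe] at hm
  exact absurd (ht.trans (h.strictMono.monotone (zero_le (a := m)))) hm.not_ge

theorem logPrice_eq_of_mem_Ioc (h : IsSwitchSeq b c τ) {m : ℕ} {t : ℝ≥0}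
    (ht : t ∈ Ioc (τ m) (τ (m + 1))) :
    logPrice b c t = phaseSign b c m * (runSup (phaseSign b c m • b) (τ m) t - c) := by
  have hiff : ∀ k : ℕ, (switchTime b c k < (t : ℝ≥0∞) ∧ (t : ℝ≥0∞) ≤ switchTime b c (k + 1)) ↔
      k = m := by
    intro k
    rw [h.switchTime_eq, h.switchTime_eq, ENNReal.coe_lt_coe, ENNReal.coe_le_coe]
    constructor
    · rintro ⟨h₁, h₂⟩
      have h₃ := h.strictMono.lt_iff_lt.1 (h₁.trans_le ht.2)
      have h₄ := h.strictMono.lt_iff_lt.1 (ht.1.trans_le h₂)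
      omega
    · rintro rfl; exact ht
  have hex : ∃ k : ℕ, switchTime b c k < (t : ℝ≥0∞) ∧ (t : ℝ≥0∞) ≤ switchTime b c (k + 1) :=
    ⟨m, (hiff m).2 rfl⟩
  -- Quantifying over the instance lets this rewrite the classical one inside `logPrice`.
  have hfind : ∀ [DecidablePred fun k : ℕ => switchTime b c k < (t : ℝ≥0∞) ∧
      (t : ℝ≥0∞) ≤ switchTime b c (k + 1)], Nat.find hex = m := (hiff _).1 (Nat.find_spec hex)
  rw [logPrice, dif_pos hex]
  rw [hfind, h.switchTime_eq, phaseSign]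
  split_ifs
  · simp
  · rw [runInf_eq_neg_runSup_neg]
    simp only [neg_smul, one_smul]
    ring

/-- Consecutive phases match at their common endpoint: the drawdown there is exactly `2c`, so both
formulas give `b` plus the old sign times `c`. At `τ 0` the value is `0` because the signed path
equals `c`. -/
theorem logPrice_eq_of_mem_Icc (h : IsSwitchSeq b c τ) {m : ℕ} {t : ℝ≥0}
    (ht : t ∈ Icc (τ m) (τ (m + 1))) :
    logPrice b c t = phaseSign b c m * (runSup (phaseSign b c m • b) (τ m) t - c) := by
  rcases ht.1.eq_or_lt with rfl | hlt
  · rw [runSup_self]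
    cases m with
    | zero => rw [h.logPrice_eq_zero le_rfl, Pi.smul_apply, smul_eq_mul, h.sign_mul]; ring
    | succ m =>
      rw [h.logPrice_eq_of_mem_Ioc ⟨h.lt_succ m, le_rfl⟩, phaseSign_succ]
      have hd := h.drawdown_eq m
      rcases phaseSign_eq_or b c m with h | h <;>
        simp only [h, neg_smul, one_smul, neg_neg, Pi.neg_apply] at hd ⊢ <;> linarith
  · exact h.logPrice_eq_of_mem_Ioc ⟨hlt, ht.2⟩

theorem isReflectedOn_logPrice (h : IsSwitchSeq b c τ) (hb : Continuous b) (m : ℕ) :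
    IsReflectedOn b c (logPrice b c) (Icc 0 (τ m)) := by
  induction m with
  | zero =>
    exact (isReflectedOn_zero fun t ht => h.abs_le t ht.2).congr
      fun t ht => h.logPrice_eq_zero ht.2
  | succ m ih =>
    refine ih.union_Icc zero_le (h.lt_succ m).le ?_
    have href := isReflectedOn_runSup_sub (hb.const_smul (phaseSign b c m)) (h.le_drawdown m)
    have heq : EqOn (logPrice b c) _ (Icc (τ m) (τ (m + 1))) :=
      fun t ht => h.logPrice_eq_of_mem_Icc ht
    rcases phaseSign_eq_or b c m with hs | hs <;> simp only [hs] at href heq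
    · rw [one_smul] at href heq
      exact href.congr fun t ht => by rw [heq ht]; exact one_mul _
    · rw [neg_smul, one_smul] at href heq
      have := href.neg
      rw [neg_neg] at this
      exact this.congr fun t ht => by rw [heq ht]; simp

theorem isReflectedPath_logPrice (h : IsSwitchSeq b c τ) (hb : Continuous b) (hc : 0 < c) :
    IsReflectedPath b c (logPrice b c) :=
  isReflectedPath_of_forall_Icc (h.logPrice_eq_zero zero_le) fun t =>
    let ⟨m, hm⟩ := h.exists_lt hb hc t
    ⟨τ m, hm, h.isReflectedOn_logPrice hb m⟩

end IsSwitchSeq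

end AMM

/-! ### Application to Brownian paths -/

namespace AMM

open MeasureTheory ProbabilityTheory Filter

theorem ae_oscillates {Ω : Type*} [MeasurableSpace Ω] {P : Measure Ω} {B : ℝ≥0 → Ω → ℝ}
    (hB : IsBrownianReal B P) (c : ℝ) : ∀ᵐ ω ∂P, Oscillates (fun t => B t ω) c := by
  filter_upwards [hB.ae_frequently_increment_mem (S := Set.Iic (-(2 * c))) measurableSet_Iic
    (by simp), hB.ae_frequently_increment_mem (S := Set.Ici (2 * c)) measurableSet_Ici (by simp)]
    with ω hdown hup N
  obtain ⟨k, hk⟩ := exists_nat_ge N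
  obtain ⟨n, hkn, hn⟩ := frequently_atTop.1 hdown k
  obtain ⟨n', hkn', hn'⟩ := frequently_atTop.1 hup k
  exact ⟨⟨n, (n + 1 : ℕ), hk.trans (Nat.cast_le.2 hkn), Nat.cast_le.2 n.le_succ, hn⟩,
    ⟨n', (n' + 1 : ℕ), hk.trans (Nat.cast_le.2 hkn'), Nat.cast_le.2 n'.le_succ, hn'⟩⟩

end AMM

theorem proposition2p1 {Ω : Type*} [MeasurableSpace Ω] {P : MeasureTheory.Measure Ω}
    {B : ℝ≥0 → Ω → ℝ} (hB : ProbabilityTheory.IsBrownianReal B P) {c : ℝ} (hc : 0 < c) :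
    (∀ᵐ ω ∂P, ∀ m : ℕ, AMM.switchTime (fun t => B t ω) c m < ⊤) ∧
    (∀ t : ℝ≥0, AEMeasurable (fun ω => AMM.logPrice (fun s => B s ω) c t) P) ∧
    (∀ᵐ ω ∂P, AMM.IsReflectedPath (fun t => B t ω) c (AMM.logPrice (fun t => B t ω) c)) ∧
    (∀ V : ℝ≥0 → Ω → ℝ,
      (∀ᵐ ω ∂P, AMM.IsReflectedPath (fun t => B t ω) c (fun t => V t ω)) →
      ∀ᵐ ω ∂P, ∀ t : ℝ≥0, V t ω = AMM.logPrice (fun s => B s ω) c t) := by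
  have hseq : ∀ᵐ ω ∂P, ∃ τ, AMM.IsSwitchSeq (fun t => B t ω) c τ := by
    filter_upwards [hB.cont, hB.eval_zero_ae_eq_zero, AMM.ae_oscillates hB c] with ω h₁ h₂ h₃
    exact AMM.exists_isSwitchSeq h₁ h₂ hc h₃
  have href : ∀ᵐ ω ∂P, AMM.IsReflectedPath (fun t => B t ω) c
      (AMM.logPrice (fun t => B t ω) c) := by
    filter_upwards [hB.cont, hseq] with ω h₁ ⟨τ, hτ⟩
    exact hτ.isReflectedPath_logPrice h₁ hc
  refine ⟨?_, fun t => ?_, href, fun V hV => ?_⟩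
  · filter_upwards [hseq] with ω ⟨τ, hτ⟩ m
    rw [hτ.switchTime_eq]
    exact ENNReal.coe_lt_top
  · exact AMM.aemeasurable_of_isReflectedPath (U := fun t ω => AMM.logPrice (fun s => B s ω) c t)
      (fun t => hB.aemeasurable t) hB.cont href t
  · filter_upwards [hB.cont, href, hV] with ω h₁ h₂ h₃ t
    exact congrFun (h₂.unique h₁ h₃) t
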